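/- Write $r=|x|$ for $x\in\mathbb{R}^2$. Let $$\mathcal{G}=\mathbb{R}^4\setminus\Big\{\Big(x,-\frac{x}{|x|^2}\Big): x\in\mathbb{R}^2\setminus\{0\}\Big\}\subseteq\mathbb{R}^2\times\mathbb{R}^2,$$ an open subset of $\mathbb{R}^4$, and let $\varphi(x,a)=(x,\,x+|x|^2a)$, which restricts to a bijection (in fact a diffeomorphism) from $\mathcal{G}\setminus(\{0\}\times\mathbb{R}^2)$ onto $(\mathbb{R}^2\setminus\{0\})\times(\mathbb{R}^2\setminus\{0\})$. Equip the latter with the structure of the pair groupoid over $\mathbb{R}^2\setminus\{0\}$, with $s(x,y)=y$, $t(x,y)=x$, $(x,y)\cdot(y,z)=(x,z)$. **Theorem.** There is one and only one Lie groupoid structure $\mathcal{G}\rightrightarrows\mathbb{R}^2$ whose structure maps extend those of the pair groupoid of $\mathbb{R}^2\setminus\{0\}$, pulled back to $\mathcal{G}\setminus(\{0\}\times\mathbb{R}^2)$ along $\varphi$. Its source and target maps are $s(x,a)=x+|x|^2a$ and $t(x,a)=x$. The Lie algebroid of $\mathcal{G}$ (the kernel of $ds$ along the units, with anchor $dt$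 and the bracket of right-invariant vector fields) is isomorphic to $\mathrm{span}(r^2\partial_{x_1},r^2\partial_{x_2})$, the Lie algebroid whose sections are the vector fields $r^2V$ with $V$ a smooth vector field on $\mathbb{R}^2$, with the bracket of vector fields and the inclusion as anchor. Moreover, $\mathcal{G}$ integrates the cotangent Lie algebroid of every elliptic Poisson structure on $(\mathbb{R}^2,\{0\})$ (these all have nonzero elliptic residue). That is: let $\mathcal{A}_{|D|}$ be the elliptic tangent bundle, whose sections are the smooth vector fields on $\mathbb{R}^2$ that preserve the ideal generated by $r^2$, let $\rho:\mathcal{A}_{|D|}\to T\mathbb{R}^2$ be its anchor, let $\omega\in\Gamma(\Lambda^2\mathcal{A}_{|D|}^*)$ be nondegenerate and closed, and let $\pi$ be the Poisson structure on $\mathbb{R}^2$ with $\pi^\sharp=\rho\circ(\omega^\flat)^{-1}\circ\rho^*$. Then the Lie algebroid of $\mathcal{G}$ is isomorphic to $(T^*\mathbb{R}^2,\pi^\sharp,[\cdot,\cdot]_\pi)$. -/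

import Mathlib

open scoped ContDiff

noncomputable section

namespace EllipticGroupoid

/-! ### Lie groupoids with an open subset of a normed space as arrows -/

/-- A function on a subset `S` of a normed space is smooth on `S`; the value of the extension
outside `S` is irrelevant. -/
def SmoothOnSubset {E F : Type*} [NormedAddCommGroup E] [NormedSpace ℝ E]
    [NormedAddCommGroup F] [NormedSpace ℝ F] (S : Set E) (f : S → F) : Prop :=
  ContDiffOn ℝ ∞ (Function.extend Subtype.val f 0) S

/-- The differential of a function defined on an open subset `S` of a normed space. -/
def differential {E F : Type*} [NormedAddCommGroup E] [NormedSpace ℝ E]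
    [NormedAddCommGroup F] [NormedSpace ℝ F] {S : Set E} (f : S → F) (g : S) : E →L[ℝ] F :=
  fderiv ℝ (Function.extend Subtype.val f 0) (g : E)

/-- A Lie groupoid `G ⇉ B`, where the manifold of arrows is an open subset `G` of a normed space
`E` and the manifold of objects is a normed space `B`. The product `mul g h` is defined when
`src g = tgt h`, as in `(x, y) (y, z) = (x, z)` with `src (x, y) = y` and `tgt (x, y) = x`. -/
structure LieGroupoid {E : Type*} [NormedAddCommGroup E] [NormedSpace ℝ E] (G : Set E)
    (B : Type*) [NormedAddCommGroup B] [NormedSpace ℝ B] where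
  isOpen_arrows : IsOpen G
  src : G → B
  tgt : G → B
  unit : B → G
  inv : G → G
  mul : (g h : G) → src g = tgt h → G
  src_unit : ∀ x, src (unit x) = x
  tgt_unit : ∀ x, tgt (unit x) = x
  src_inv : ∀ g : G, src (inv g) = tgt g
  tgt_inv : ∀ g : G, tgt (inv g) = src g
  src_mul : ∀ (g h : G) (e : src g = tgt h), src (mul g h e) = src h
  tgt_mul : ∀ (g h : G) (e : src g = tgt h), tgt (mul g h e) = tgt g
  unit_mul : ∀ g : G, mul (unit (tgt g)) g (src_unit _) = g
  mul_unit : ∀ g : G, mul g (unit (src g)) (tgt_unit _).symm = g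
  mul_assoc : ∀ (g h k : G) (e : src g = tgt h) (e' : src h = tgt k),
    mul (mul g h e) k ((src_mul g h e).trans e') = mul g (mul h k e') (e.trans (tgt_mul h k e').symm)
  inv_mul : ∀ g : G, mul (inv g) g (src_inv g) = unit (src g)
  mul_inv : ∀ g : G, mul g (inv g) (tgt_inv g).symm = unit (tgt g)
  smooth_src : SmoothOnSubset G src
  smooth_tgt : SmoothOnSubset G tgt
  smooth_unit : ContDiff ℝ ∞ (fun x => (unit x : E))
  smooth_inv : SmoothOnSubset G (fun g => (inv g : E))
  smooth_mul : ∃ μ : E × E → E,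
    ContDiffOn ℝ ∞ μ {p | ∃ g h : G, src g = tgt h ∧ p = ((g : E), (h : E))} ∧
      ∀ (g h : G) (e : src g = tgt h), μ ((g : E), (h : E)) = mul g h e
  submersion_src : ∀ g : G, Function.Surjective (differential src g)
  submersion_tgt : ∀ g : G, Function.Surjective (differential tgt g)

namespace LieGroupoid

variable {E : Type*} [NormedAddCommGroup E] [NormedSpace ℝ E] {G : Set E}
  {B : Type*} [NormedAddCommGroup B] [NormedSpace ℝ B]

/-- `X` is a smooth right-invariant vector field on the arrows: it is tangent to the source fibres,
and right multiplication by `h`, a map between source fibres, sends `X g` to `X (g h)`. The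
differential of right multiplication is expressed by its action on curves in a source fibre. -/
def IsRightInvariant (𝒢 : LieGroupoid G B) (X : E → E) : Prop :=
  ContDiffOn ℝ ∞ X G ∧
  (∀ g : G, differential 𝒢.src g (X g) = 0) ∧
  ∀ (g h : G) (e : 𝒢.src g = 𝒢.tgt h) (γ : ℝ → G) (hγ : ∀ τ, 𝒢.src (γ τ) = 𝒢.tgt h),
    γ 0 = g → HasDerivAt (fun τ => (γ τ : E)) (X g) 0 →
      HasDerivAt (fun τ => (𝒢.mul (γ τ) h (hγ τ) : E)) (X (𝒢.mul g h e)) 0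

/-- The fibre at `x` of the Lie algebroid of `𝒢`: the kernel of the differential of the source map
at the unit arrow of `x`. -/
def algebroidFibre (𝒢 : LieGroupoid G B) (x : B) : Submodule ℝ E :=
  LinearMap.ker (differential 𝒢.src (𝒢.unit x)).toLinearMap

/-- The anchor of the Lie algebroid of `𝒢`: the differential of the target map (restricted to
`algebroidFibre 𝒢 x`). -/
def algebroidAnchor (𝒢 : LieGroupoid G B) (x : B) : E →L[ℝ] B :=
  differential 𝒢.tgt (𝒢.unit x)

/-- `U` is the bracket, in the Lie algebroid of `𝒢`, of the sections `V` and `W`: the restriction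
to the units of the Lie bracket of the right-invariant vector fields extending `V` and `W`. -/
def IsAlgebroidBracket (𝒢 : LieGroupoid G B) (V W U : B → E) : Prop :=
  ∃ X Y : E → E, 𝒢.IsRightInvariant X ∧ 𝒢.IsRightInvariant Y ∧
    (∀ x, X (𝒢.unit x) = V x) ∧ (∀ x, Y (𝒢.unit x) = W x) ∧
    ∀ x, U x = VectorField.lieBracket ℝ X Y (𝒢.unit x)

/-- `𝒢` integrates the Lie algebroid on the trivial bundle `B × A → B` with the given anchor and
the given bracket of sections: there is an isomorphism `Φ` of vector bundles over the identity of
`B`, from `B × A` to the Lie algebroid of `𝒢`, that respects anchors and brackets. -/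
def Integrates {A : Type*} [NormedAddCommGroup A] [NormedSpace ℝ A] (𝒢 : LieGroupoid G B)
    (anchor : B → A →L[ℝ] B) (bracket : (B → A) → (B → A) → B → A) : Prop :=
  ∃ Φ : B → A →L[ℝ] E, ContDiff ℝ ∞ Φ ∧
    (∀ x, Function.Injective (Φ x)) ∧
    (∀ x, LinearMap.range (Φ x).toLinearMap = 𝒢.algebroidFibre x) ∧
    (∀ x a, 𝒢.algebroidAnchor x (Φ x a) = anchor x a) ∧
    ∀ α β : B → A, ContDiff ℝ ∞ α → ContDiff ℝ ∞ β →
      𝒢.IsAlgebroidBracket (fun x => Φ x (α x)) (fun x => Φ x (β x))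
        (fun x => Φ x (bracket α β x))

end LieGroupoid

/-! ### The weighted blow-up of the pair groupoid -/

/-- The plane. -/
abbrev Plane : Type := EuclideanSpace ℝ (Fin 2)

/-- The space of arrows: the complement in `ℝ⁴ = ℝ² × ℝ²` of the graph of `x ↦ - x / |x|²` over the
punctured plane. -/
def arrows : Set (Plane × Plane) :=
  {p : Plane × Plane | p.1 ≠ 0 ∧ p.2 = -((‖p.1‖ ^ 2)⁻¹ • p.1)}ᶜ

/-- The blow-down map `(x, a) ↦ (x, x + |x|² a)`. -/
def blowDown (p : Plane × Plane) : Plane × Plane :=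
  (p.1, p.1 + ‖p.1‖ ^ 2 • p.2)

/-- The arrows outside `{0} × ℝ²` are identified by the blow-down map with the arrows of the pair
groupoid of the punctured plane. -/
theorem bijOn_blowDown :
    Set.BijOn blowDown (arrows \ {p | p.1 = 0}) {q | q.1 ≠ 0 ∧ q.2 ≠ 0} := by
  refine ⟨?_, ?_, ?_⟩
  · rintro ⟨x, a⟩ ⟨hp, hx⟩
    have hx : x ≠ 0 := hx
    have hn : ‖x‖ ^ 2 ≠ 0 := by simpa using hx
    refine ⟨hx, fun h => hp ⟨hx, ?_⟩⟩
    have h : x + ‖x‖ ^ 2 • a = 0 := h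
    have h' : ‖x‖ ^ 2 • a = -x := by rw [← add_eq_zero_iff_eq_neg, add_comm]; exact h
    change a = -((‖x‖ ^ 2)⁻¹ • x)
    rw [← smul_neg, ← h', smul_smul, inv_mul_cancel₀ hn, one_smul]
  · rintro ⟨x, a⟩ ⟨-, hx⟩ ⟨y, b⟩ - h
    have hx : x ≠ 0 := hx
    have hn : ‖x‖ ^ 2 ≠ 0 := by simpa using hx
    simp only [blowDown, Prod.mk.injEq] at h
    obtain ⟨rfl, h⟩ := h
    have h := smul_right_injective Plane hn (add_left_cancel h)
    rw [h]
  · rintro ⟨x, y⟩ ⟨hx, hy⟩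
    have hx : x ≠ 0 := hx
    have hy : y ≠ 0 := hy
    have hn : ‖x‖ ^ 2 ≠ 0 := by simpa using hx
    refine ⟨(x, (‖x‖ ^ 2)⁻¹ • (y - x)), ⟨?_, hx⟩, ?_⟩
    · rintro ⟨-, h⟩
      have h : (‖x‖ ^ 2)⁻¹ • (y - x) = -((‖x‖ ^ 2)⁻¹ • x) := h
      rw [← smul_neg] at h
      have h := smul_right_injective Plane (inv_ne_zero hn) h
      exact hy (by simpa using h)
    · simp [blowDown, smul_smul, mul_inv_cancel₀ hn]

/-- The structure maps of `𝒢` restrict, over the punctured plane, to the structure maps of the pair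
groupoid of the punctured plane, pulled back along the bijection given by the blow-down map:
`s (x, y) = y`, `t (x, y) = x`, `u x = (x, x)`, `(x, y)⁻¹ = (y, x)`, `(x, y) (y, z) = (x, z)`. -/
structure ExtendsPairGroupoid (𝒢 : LieGroupoid arrows Plane) : Prop where
  src_eq : ∀ g : arrows, g.1.1 ≠ 0 → 𝒢.src g = (blowDown g).2
  tgt_eq : ∀ g : arrows, g.1.1 ≠ 0 → 𝒢.tgt g = (blowDown g).1
  unit_eq : ∀ x : Plane, x ≠ 0 → blowDown (𝒢.unit x) = (x, x)
  inv_eq : ∀ g : arrows, g.1.1 ≠ 0 → blowDown (𝒢.inv g) = ((blowDown g).2, (blowDown g).1)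
  mul_eq : ∀ (g h : arrows) (e : 𝒢.src g = 𝒢.tgt h), g.1.1 ≠ 0 → h.1.1 ≠ 0 →
    blowDown (𝒢.mul g h e) = ((blowDown g).1, (blowDown h).2)

/-! ### The elliptic tangent bundle of the plane with divisor the origin -/

/-- The ring of smooth functions on the plane. -/
def smoothFunctions : Subalgebra ℝ (Plane → ℝ) where
  carrier := {f | ContDiff ℝ ∞ f}
  mul_mem' {f g} hf hg := by
    have hf : ContDiff ℝ ∞ f := hf
    have hg : ContDiff ℝ ∞ g := hg
    exact hf.mul hg
  add_mem' {f g} hf hg := by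
    have hf : ContDiff ℝ ∞ f := hf
    have hg : ContDiff ℝ ∞ g := hg
    exact hf.add hg
  algebraMap_mem' c := (contDiff_const : ContDiff ℝ ∞ fun _ : Plane => c)

theorem smoothFunctions_contDiff (f : smoothFunctions) : ContDiff ℝ ∞ (f : Plane → ℝ) := f.2

/-- The elliptic ideal, generated by `r²`. -/
def ellipticIdeal : Ideal smoothFunctions :=
  Ideal.span {⟨fun x => ‖x‖ ^ 2, (contDiff_norm_sq ℝ : ContDiff ℝ ∞ fun x : Plane => ‖x‖ ^ 2)⟩}

/-- The derivative `X f` of a smooth function along a smooth vector field. -/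
def derivAlong (X : Plane → Plane) (hX : ContDiff ℝ ∞ X) (f : smoothFunctions) :
    smoothFunctions :=
  ⟨fun x => fderiv ℝ (f : Plane → ℝ) x (X x),
    (((smoothFunctions_contDiff f).fderiv_right (m := ∞) (by simp)).clm_apply hX :
      ContDiff ℝ ∞ fun x => fderiv ℝ (f : Plane → ℝ) x (X x))⟩

/-- The sections of the elliptic tangent bundle: the smooth vector fields on the plane that
preserve the elliptic ideal. -/
def ellipticFields : Submodule smoothFunctions (Plane → Plane) where
  carrier := {X | ∃ hX : ContDiff ℝ ∞ X, ∀ f ∈ ellipticIdeal, derivAlong X hX f ∈ ellipticIdeal}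
  zero_mem' := ⟨contDiff_const, fun f _ => by
    convert ellipticIdeal.zero_mem
    ext x
    exact map_zero (fderiv ℝ (f : Plane → ℝ) x)⟩
  add_mem' := by
    rintro X Y ⟨hX, hX'⟩ ⟨hY, hY'⟩
    refine ⟨hX.add hY, fun f hf => ?_⟩
    convert ellipticIdeal.add_mem (hX' f hf) (hY' f hf)
    ext x
    exact map_add (fderiv ℝ (f : Plane → ℝ) x) (X x) (Y x)
  smul_mem' := by
    rintro c X ⟨hX, hX'⟩
    refine ⟨(smoothFunctions_contDiff c).smul hX, fun f hf => ?_⟩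
    convert ellipticIdeal.mul_mem_left c (hX' f hf)
    ext x
    exact map_smul (fderiv ℝ (f : Plane → ℝ) x) (c.1 x) (X x)

theorem lieBracket_mem (X Y : ellipticFields) :
    VectorField.lieBracket ℝ (X : Plane → Plane) Y ∈ ellipticFields := by
  obtain ⟨X, hX, hX'⟩ := X
  obtain ⟨Y, hY, hY'⟩ := Y
  refine ⟨hX.lieBracket_vectorField hY (by simp), fun f hf => ?_⟩
  convert ellipticIdeal.sub_mem (hX' _ (hY' f hf)) (hY' _ (hX' f hf))
  ext x
  exact VectorField.fderiv_apply_lieBracket (smoothFunctions_contDiff f).contDiffAt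
    (by simp only [minSmoothness_of_isRCLikeNormedField]; exact ENat.LEInfty.out)
    (hY.differentiable (by simp) x) (hX.differentiable (by simp) x)

/-- The Lie bracket of sections of the elliptic tangent bundle. -/
def ellipticBracket (X Y : ellipticFields) : ellipticFields :=
  ⟨VectorField.lieBracket ℝ (X : Plane → Plane) Y, lieBracket_mem X Y⟩

/-- The derivative of a smooth function along the anchor of a section of the elliptic tangent
bundle. -/
def ellipticDeriv (X : ellipticFields) (f : smoothFunctions) : smoothFunctions :=
  derivAlong X X.2.choose f

/-- An elliptic symplectic form: a two-form on the elliptic tangent bundle, given by its values on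
sections, that is nondegenerate and closed for the Lie algebroid differential. -/
structure IsEllipticSymplectic
    (Ω : ellipticFields →ₗ[smoothFunctions] Module.Dual smoothFunctions ellipticFields) :
    Prop where
  alternating : ∀ X, Ω X X = 0
  nondegenerate : Function.Bijective Ω
  closed : ∀ X Y Z,
    ellipticDeriv X (Ω Y Z) + ellipticDeriv Y (Ω Z X) + ellipticDeriv Z (Ω X Y)
      - Ω (ellipticBracket X Y) Z - Ω (ellipticBracket Y Z) X - Ω (ellipticBracket Z X) Y = 0

/-- `P` is the bundle map `π♯ : T*ℝ² → Tℝ²` of an elliptic Poisson structure `π` on the plane with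
divisor the origin: `π♯ = ρ ∘ (Ω♭)⁻¹ ∘ ρ*` for an elliptic symplectic form `Ω`, where `ρ` is the
anchor of the elliptic tangent bundle and `Ω♭ X = Ω (X, ·)`. -/
def IsEllipticPoisson (P : Plane → (Plane →L[ℝ] ℝ) →L[ℝ] Plane) : Prop :=
  ∃ Ω : ellipticFields →ₗ[smoothFunctions] Module.Dual smoothFunctions ellipticFields,
    IsEllipticSymplectic Ω ∧
    ∀ α : Plane → Plane →L[ℝ] ℝ, ContDiff ℝ ∞ α →
      ∃ X : ellipticFields, (∀ (Y : ellipticFields) (x : Plane),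
          (Ω X Y : Plane → ℝ) x = α x ((Y : Plane → Plane) x)) ∧
        ∀ x, P x (α x) = (X : Plane → Plane) x

/-! ### The two Lie algebroids -/

/-- The Lie derivative of a one-form along a vector field. -/
def lieDerivOneForm (X : Plane → Plane) (β : Plane → Plane →L[ℝ] ℝ) (x : Plane) :
    Plane →L[ℝ] ℝ :=
  fderiv ℝ β x (X x) + (β x).comp (fderiv ℝ X x)

/-- The bracket of the cotangent Lie algebroid of a Poisson structure with bundle map `P = π♯`:
`[α, β] = L_{π♯ α} β - L_{π♯ β} α - d (π (α, β))`, where `π (α, β) = β (π♯ α)`. -/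
def cotangentBracket (P : Plane → (Plane →L[ℝ] ℝ) →L[ℝ] Plane)
    (α β : Plane → Plane →L[ℝ] ℝ) (x : Plane) : Plane →L[ℝ] ℝ :=
  lieDerivOneForm (fun y => P y (α y)) β x - lieDerivOneForm (fun y => P y (β y)) α x
    - fderiv ℝ (fun y => β y (P y (α y))) x

/-- The anchor of the Lie algebroid `span (r² ∂₁, r² ∂₂)`, trivialised by its frame. -/
def spanAnchor (x : Plane) : Plane →L[ℝ] Plane :=
  ‖x‖ ^ 2 • ContinuousLinearMap.id ℝ Plane

/-- The bracket of the Lie algebroid `span (r² ∂₁, r² ∂₂)`, trivialised by its frame: the bracket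
of vector fields `[r² V, r² W]`, divided by `r²`. -/
def spanBracket (V W : Plane → Plane) (x : Plane) : Plane :=
  ‖x‖ ^ 2 • VectorField.lieBracket ℝ V W x
    + (2 * inner ℝ x (V x)) • W x - (2 * inner ℝ x (W x)) • V x

theorem spanAnchor_spanBracket (V W : Plane → Plane) (hV : ContDiff ℝ ∞ V) (hW : ContDiff ℝ ∞ W)
    (x : Plane) : spanAnchor x (spanBracket V W x) =
      VectorField.lieBracket ℝ (fun y => spanAnchor y (V y)) (fun y => spanAnchor y (W y)) x := by
  have hV := hV.differentiable (by simp) x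
  have hW := hW.differentiable (by simp) x
  have hn : HasFDerivAt (fun y : Plane => ‖y‖ ^ 2) (2 • innerSL ℝ x) x :=
    (hasStrictFDerivAt_norm_sq x).hasFDerivAt
  simp only [spanAnchor, spanBracket, VectorField.lieBracket, smul_apply,
    ContinuousLinearMap.id_apply]
  rw [(hn.fun_smul hV.hasFDerivAt).fderiv, (hn.fun_smul hW.hasFDerivAt).fderiv]
  simp only [add_apply, smul_apply,
    ContinuousLinearMap.smulRight_apply, innerSL_apply_apply, map_smul]
  module

end EllipticGroupoid

end

/-!
A pair `(x, a)` stands for the arrow from `y = x + |x|² a` to `x`. The ratio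
`c = |y|² / |x|² = 1 + 2⟪x, a⟫ + |x|² |a|²` is a polynomial in `(x, a)`, and `𝒢` is the locus where
it does not vanish. The pair groupoid becomes `(x, a) (y, b) = (x, a + c b)` and
`(x, a)⁻¹ = (y, -c⁻¹ a)`, formulas that are smooth across `x = 0`. They are the only possible ones:
the arrows over the punctured plane are dense, hence so are the composable pairs over it, because
the target map is open; and the product determines units and inverses.

The derivative of the source at `(x, 0)` is `(w, v) ↦ w + |x|² v`, so its kernel consists of the
vectors `(-|x|² v, v)`, on which the derivative of the target is multiplication by `-|x|²`.

Let `Ω` be an elliptic symplectic form, `E` the Euler field, `R` the rotational field and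
`u = Ω(E, R)`. As `E` and `R` span off the origin, `u X = Ω(X, R) E - Ω(X, E) R` for every
elliptic field `X`. Nondegeneracy provides `Z` with `Ω(Z, ·) = d log r`, and then `u Z = -R`. Since
`Z` vanishes at the origin whereas the linear part of `R` is invertible, `u` vanishes nowhere. Hence
`π = r² u⁻¹ ∂₁ ∧ ∂₂`, and `u⁻¹ (∂₁ ∧ ∂₂)^♯` is an isomorphism from `T*ℝ²` onto the span of
`r² ∂₁, r² ∂₂`.
-/

noncomputable section

namespace EllipticGroupoid

section OpenSubset

variable {E F : Type*} [NormedAddCommGroup E] [NormedSpace ℝ E]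
  [NormedAddCommGroup F] [NormedSpace ℝ F] {S : Set E}

theorem extend_val_apply {X Y : Type*} [Zero Y] {S : Set X} (f : S → Y) (g : S) :
    Function.extend Subtype.val f 0 (g : X) = f g :=
  Subtype.val_injective.extend_apply f 0 g

theorem SmoothOnSubset.of_contDiffOn {f : S → F} {f' : E → F} (hf : ContDiffOn ℝ ∞ f' S)
    (h : ∀ g : S, f g = f' g) : SmoothOnSubset S f :=
  hf.congr fun x hx => (extend_val_apply f ⟨x, hx⟩).trans (h ⟨x, hx⟩)

theorem SmoothOnSubset.continuous {f : S → F} (hf : SmoothOnSubset S f) : Continuous f :=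
  (continuousOn_iff_continuous_domRestrict.1 (ContDiffOn.continuousOn hf)).congr
    (extend_val_apply f)

theorem differential_eq_of_hasFDerivAt (hS : IsOpen S) {f : S → F} {f' : E → F}
    (h : ∀ g : S, f g = f' g) {g : S} {L : E →L[ℝ] F} (hL : HasFDerivAt f' L (g : E)) :
    differential f g = L := by
  refine (hL.congr_of_eventuallyEq ?_).fderiv
  filter_upwards [hS.mem_nhds g.2] with x hx
  exact (extend_val_apply f ⟨x, hx⟩).trans (h ⟨x, hx⟩)

theorem SmoothOnSubset.isOpenMap_of_surjective_differential [CompleteSpace E] [CompleteSpace F]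
    (hS : IsOpen S) {f : S → F} (hf : SmoothOnSubset S f)
    (hsurj : ∀ g, Function.Surjective (differential f g)) : IsOpenMap f := by
  refine isOpenMap_iff_nhds_le.2 fun g => ge_of_eq ?_
  have hstrict : HasStrictFDerivAt (Function.extend Subtype.val f 0) (differential f g) (g : E) :=
    (ContDiffOn.contDiffAt hf (hS.mem_nhds g.2)).hasStrictFDerivAt (by simp)
  have hmap := hstrict.map_nhds_eq_of_surj (LinearMap.range_eq_top.2 (hsurj g))
  have hcomp : Function.extend Subtype.val f 0 ∘ Subtype.val = f := funext (extend_val_apply f)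
  rwa [extend_val_apply, ← hS.isOpenEmbedding_subtypeVal.map_nhds_eq, Filter.map_map,
    hcomp] at hmap

end OpenSubset

theorem isOpenMap_pullback_fst {X Y Z : Type*} [TopologicalSpace X] [TopologicalSpace Y]
    [TopologicalSpace Z] {f : X → Z} {g : Y → Z} (hf : Continuous f) (hg : IsOpenMap g) :
    IsOpenMap (Function.Pullback.fst : f.Pullback g → X) := by
  rintro _ ⟨W, hW, rfl⟩
  refine isOpen_iff_mem_nhds.2 ?_
  rintro _ ⟨⟨⟨x, y⟩, e⟩, hxy, rfl⟩
  obtain ⟨U, U', hU, hU', hx, hy, hUW⟩ := isOpen_prod_iff.1 hW x y hxy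
  filter_upwards [hU.mem_nhds hx, ((hg U' hU').preimage hf).mem_nhds ⟨y, hy, e.symm⟩]
    with x' hx' ⟨y', hy', e'⟩
  exact ⟨⟨(x', y'), e'.symm⟩, hUW ⟨hx', hy'⟩, rfl⟩

namespace LieGroupoid

variable {E : Type*} [NormedAddCommGroup E] [NormedSpace ℝ E] {G : Set E}
  {B : Type*} [NormedAddCommGroup B] [NormedSpace ℝ B]

theorem mul_congr (𝒢 : LieGroupoid G B) {g g' h h' : G} (hg : g = g') (hh : h = h')
    (e : 𝒢.src g = 𝒢.tgt h) : 𝒢.mul g h e = 𝒢.mul g' h' (hg ▸ hh ▸ e) := by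
  subst hg hh
  rfl

theorem eq_inv_of_mul_eq_unit (𝒢 : LieGroupoid G B) {g h : G} (e : 𝒢.src g = 𝒢.tgt h)
    (hgh : 𝒢.mul g h e = 𝒢.unit (𝒢.tgt g)) : h = 𝒢.inv g :=
  calc
    h = 𝒢.mul (𝒢.unit (𝒢.tgt h)) h (𝒢.src_unit _) := (𝒢.unit_mul h).symm
    _ = 𝒢.mul (𝒢.mul (𝒢.inv g) g (𝒢.src_inv g)) h ((𝒢.src_mul _ _ _).trans e) :=
      𝒢.mul_congr (by rw [inv_mul, e]) rfl _
    _ = 𝒢.mul (𝒢.inv g) (𝒢.mul g h e) ((𝒢.src_inv g).trans (𝒢.tgt_mul g h e).symm) :=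
      𝒢.mul_assoc _ _ _ _ _
    _ = 𝒢.mul (𝒢.inv g) (𝒢.unit (𝒢.src (𝒢.inv g))) (𝒢.tgt_unit _).symm :=
      𝒢.mul_congr rfl (by rw [hgh, src_inv]) _
    _ = 𝒢.inv g := 𝒢.mul_unit _

theorem eq_unit_of_mul_self (𝒢 : LieGroupoid G B) {g : G} (e : 𝒢.src g = 𝒢.tgt g)
    (hg : 𝒢.mul g g e = g) : g = 𝒢.unit (𝒢.tgt g) :=
  calc
    g = 𝒢.mul (𝒢.unit (𝒢.tgt g)) g (𝒢.src_unit _) := (𝒢.unit_mul g).symm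
    _ = 𝒢.mul (𝒢.mul (𝒢.inv g) g (𝒢.src_inv g)) g ((𝒢.src_mul _ _ _).trans e) :=
      𝒢.mul_congr (by rw [inv_mul, e]) rfl _
    _ = 𝒢.mul (𝒢.inv g) (𝒢.mul g g e) ((𝒢.src_inv g).trans (𝒢.tgt_mul g g e).symm) :=
      𝒢.mul_assoc _ _ _ _ _
    _ = 𝒢.mul (𝒢.inv g) g (𝒢.src_inv g) := 𝒢.mul_congr rfl hg _
    _ = 𝒢.unit (𝒢.tgt g) := by rw [inv_mul, e]

variable {𝒢 𝒢' : LieGroupoid G B}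

theorem ext_of_mul (hs : 𝒢.src = 𝒢'.src) (ht : 𝒢.tgt = 𝒢'.tgt)
    (hm : ∀ g h e e', 𝒢.mul g h e = 𝒢'.mul g h e') : 𝒢 = 𝒢' := by
  have hu : 𝒢.unit = 𝒢'.unit := funext fun x => by
    have hx : 𝒢'.tgt (𝒢.unit x) = x := ht ▸ 𝒢.tgt_unit x
    have e : 𝒢.src (𝒢.unit x) = 𝒢.tgt (𝒢.unit x) := by rw [src_unit, tgt_unit]
    have hself : 𝒢.mul (𝒢.unit x) (𝒢.unit x) e = 𝒢.unit x :=
      (𝒢.mul_congr (by rw [tgt_unit]) rfl e).trans (𝒢.unit_mul _)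
    have h := 𝒢'.eq_unit_of_mul_self (hs ▸ ht ▸ e) ((hm _ _ e _).symm.trans hself)
    rwa [hx] at h
  have hi : 𝒢.inv = 𝒢'.inv := funext fun g => by
    have e := (𝒢.tgt_inv g).symm
    refine 𝒢'.eq_inv_of_mul_eq_unit (hs ▸ ht ▸ e) ((hm _ _ e _).symm.trans ?_)
    rw [mul_inv, hu, ht]
  cases 𝒢
  cases 𝒢'
  dsimp only at hs ht hu hi hm
  subst hs ht hu hi
  obtain rfl := funext fun g => funext fun h => funext fun e => hm g h e e
  rfl

theorem continuous_mul (𝒢 : LieGroupoid G B) :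
    Continuous fun p : 𝒢.src.Pullback 𝒢.tgt => 𝒢.mul p.fst p.snd p.2 := by
  obtain ⟨μ, hμ, hmul⟩ := 𝒢.smooth_mul
  have hpair : Continuous fun p : 𝒢.src.Pullback 𝒢.tgt => ((p.fst : E), (p.snd : E)) := by
    unfold Function.Pullback.fst Function.Pullback.snd
    fun_prop
  exact continuous_induced_rng.2 ((hμ.continuousOn.comp_continuous hpair
    fun p => ⟨_, _, p.2, rfl⟩).congr fun p => hmul _ _ p.2)

theorem eq_of_eqOn_dense [CompleteSpace E] [CompleteSpace B] {D : Set G} (hD : Dense D)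
    (hs : Set.EqOn 𝒢.src 𝒢'.src D) (ht : Set.EqOn 𝒢.tgt 𝒢'.tgt D)
    (hm : ∀ g ∈ D, ∀ h e e', 𝒢.mul g h e = 𝒢'.mul g h e') : 𝒢 = 𝒢' := by
  have hsrc : 𝒢.src = 𝒢'.src := 𝒢.smooth_src.continuous.ext_on hD 𝒢'.smooth_src.continuous hs
  have htgt : 𝒢.tgt = 𝒢'.tgt := 𝒢.smooth_tgt.continuous.ext_on hD 𝒢'.smooth_tgt.continuous ht
  have tgt_open : IsOpenMap 𝒢.tgt :=
    𝒢.smooth_tgt.isOpenMap_of_surjective_differential 𝒢.isOpen_arrows 𝒢.submersion_tgt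
  have dense_pairs : Dense {p : 𝒢.src.Pullback 𝒢.tgt | p.fst ∈ D} :=
    hD.preimage (isOpenMap_pullback_fst 𝒢.smooth_src.continuous tgt_open)
  let toPair' (p : 𝒢.src.Pullback 𝒢.tgt) : 𝒢'.src.Pullback 𝒢'.tgt := ⟨p.1, hsrc ▸ htgt ▸ p.2⟩
  have hmul := 𝒢.continuous_mul.ext_on dense_pairs
    (𝒢'.continuous_mul.comp (continuous_subtype_val.subtype_mk _ : Continuous toPair'))
    fun p hp => hm _ hp _ _ _
  exact ext_of_mul hsrc htgt fun g h e _ => congrFun hmul ⟨(g, h), e⟩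

theorem Integrates.of_bundleIso {A A' : Type*} [NormedAddCommGroup A] [NormedSpace ℝ A]
    [NormedAddCommGroup A'] [NormedSpace ℝ A'] {anchor : B → A →L[ℝ] B}
    {bracket : (B → A) → (B → A) → B → A} {anchor' : B → A' →L[ℝ] B}
    {bracket' : (B → A') → (B → A') → B → A'} (h : 𝒢.Integrates anchor bracket)
    {Ψ : B → A' →L[ℝ] A} (hΨ : ContDiff ℝ ∞ Ψ) (hbij : ∀ x, Function.Bijective (Ψ x))
    (hanchor : ∀ x a, anchor x (Ψ x a) = anchor' x a)
    (hbracket : ∀ α β : B → A', ContDiff ℝ ∞ α → ContDiff ℝ ∞ β → ∀ x,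
      Ψ x (bracket' α β x) = bracket (fun y => Ψ y (α y)) (fun y => Ψ y (β y)) x) :
    𝒢.Integrates anchor' bracket' := by
  obtain ⟨Φ, hΦ, Φ_inj, Φ_range, Φ_anchor, Φ_bracket⟩ := h
  refine ⟨fun x => (Φ x).comp (Ψ x), hΦ.clm_comp hΨ, fun x => (Φ_inj x).comp (hbij x).1,
    fun x => ?_, fun x a => (Φ_anchor x _).trans (hanchor x a), fun α β hα hβ => ?_⟩
  · rw [← Φ_range, ContinuousLinearMap.toLinearMap_comp]
    exact LinearMap.range_comp_of_range_eq_top _ (LinearMap.range_eq_top.2 (hbij x).2)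
  · simpa only [ContinuousLinearMap.comp_apply, hbracket α β hα hβ]
      using Φ_bracket _ _ (hΨ.clm_apply hα) (hΨ.clm_apply hβ)

end LieGroupoid

section BlowUp

variable {V : Type*} [NormedAddCommGroup V] [InnerProductSpace ℝ V]

/-- The squared ratio `|s|² / |t|²` of source to target of the arrow `(x, a)`, written as a
polynomial so that it makes sense at `x = 0`. -/
def dilation (p : V × V) : ℝ :=
  1 + 2 * inner ℝ p.1 p.2 + ‖p.1‖ ^ 2 * ‖p.2‖ ^ 2

/-- The source of an arrow. -/
def source (p : V × V) : V :=
  p.1 + ‖p.1‖ ^ 2 • p.2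

/-- The product of two arrows, meaningful when `source p = q.1`. -/
def product (p q : V × V) : V × V :=
  (p.1, p.2 + dilation p • q.2)

/-- The inverse of an arrow, meaningful when `dilation p ≠ 0`. -/
def inverse (p : V × V) : V × V :=
  (source p, -((dilation p)⁻¹ • p.2))

variable (V) in
/-- The arrows of the weighted blow-up at the origin of the pair groupoid of `V`, given for
`V = Plane` by the same formula as `arrows`. -/
def blowUpArrows : Set (V × V) :=
  {p : V × V | p.1 ≠ 0 ∧ p.2 = -((‖p.1‖ ^ 2)⁻¹ • p.1)}ᶜ

theorem norm_source_sq (p : V × V) : ‖source p‖ ^ 2 = ‖p.1‖ ^ 2 * dilation p := by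
  rw [source, norm_add_sq_real, inner_smul_right, norm_smul, norm_pow, norm_norm, dilation]
  ring

theorem source_eq_zero_iff {p : V × V} : source p = 0 ↔ p.1 = 0 ∨ dilation p = 0 := by
  rw [← norm_eq_zero, ← sq_eq_zero_iff, norm_source_sq, mul_eq_zero, sq_eq_zero_iff, norm_eq_zero]

theorem mem_blowUpArrows_iff {p : V × V} : p ∈ blowUpArrows V ↔ dilation p ≠ 0 := by
  refine not_congr ?_
  by_cases hx : p.1 = 0
  · simp [hx, dilation]
  have hn : ‖p.1‖ ^ 2 ≠ 0 := by simpa using hx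
  calc
    (p.1 ≠ 0 ∧ p.2 = -((‖p.1‖ ^ 2)⁻¹ • p.1)) ↔ source p = 0 := by
      rw [source, and_iff_right hx, ← smul_neg, eq_inv_smul_iff₀ hn, add_eq_zero_iff_neg_eq,
        eq_comm]
    _ ↔ dilation p = 0 := by rw [source_eq_zero_iff, or_iff_right hx]

theorem dilation_product {p q : V × V} (h : source p = q.1) :
    dilation (product p q) = dilation p * dilation q := by
  have hn : ‖q.1‖ ^ 2 = ‖p.1‖ ^ 2 * dilation p := by rw [← h, norm_source_sq]
  have hi : inner ℝ q.1 q.2 = inner ℝ p.1 q.2 + ‖p.1‖ ^ 2 * inner ℝ p.2 q.2 := by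
    rw [← h, source, inner_add_left, real_inner_smul_left]
  rw [dilation.eq_def q, hn, hi, dilation.eq_def (product p q), product]
  dsimp only
  rw [norm_add_sq_real, inner_add_right, inner_smul_right, inner_smul_right, norm_smul, mul_pow,
    Real.norm_eq_abs, sq_abs]
  linear_combination (dilation.eq_def p).symm

theorem dilation_inverse {p : V × V} (h : dilation p ≠ 0) :
    dilation (inverse p) = (dilation p)⁻¹ := by
  rw [dilation.eq_def (inverse p), inverse]
  dsimp only
  rw [norm_source_sq, norm_neg, norm_smul, inner_neg_right, inner_smul_right, source,
    inner_add_left, real_inner_smul_left, real_inner_self_eq_norm_sq, mul_pow,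
    Real.norm_eq_abs, sq_abs]
  field_simp
  rw [dilation]
  ring

theorem source_product {p q : V × V} (h : source p = q.1) : source (product p q) = source q := by
  rw [source.eq_def q, ← h, norm_source_sq, source, source, product]
  module

theorem source_inverse {p : V × V} (h : dilation p ≠ 0) : source (inverse p) = p.1 := by
  rw [source, inverse]
  dsimp only
  rw [norm_source_sq, smul_neg, smul_smul, mul_assoc, mul_inv_cancel₀ h, mul_one, source]
  abel

theorem contDiff_dilation : ContDiff ℝ ∞ (dilation : V × V → ℝ) :=
  (contDiff_const.add (contDiff_const.mul (contDiff_fst.inner ℝ contDiff_snd))).add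
    ((contDiff_fst.norm_sq ℝ).mul (contDiff_snd.norm_sq ℝ))

theorem contDiff_source : ContDiff ℝ ∞ (source : V × V → V) :=
  contDiff_fst.add ((contDiff_fst.norm_sq ℝ).smul contDiff_snd)

theorem contDiffOn_inverse : ContDiffOn ℝ ∞ inverse (blowUpArrows V) :=
  contDiff_source.contDiffOn.prodMk
    ((contDiff_dilation.contDiffOn.inv fun _ => mem_blowUpArrows_iff.1).smul
      contDiff_snd.contDiffOn).neg

theorem contDiff_product : ContDiff ℝ ∞ fun p : (V × V) × (V × V) => product p.1 p.2 :=
  (contDiff_fst.comp contDiff_fst).prodMk ((contDiff_snd.comp contDiff_fst).add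
    ((contDiff_dilation.comp contDiff_fst).smul (contDiff_snd.comp contDiff_snd)))

theorem isOpen_blowUpArrows : IsOpen (blowUpArrows V) := by
  have h : blowUpArrows V = dilation ⁻¹' {0}ᶜ := Set.ext fun _ => mem_blowUpArrows_iff
  rw [h]
  exact isOpen_compl_singleton.preimage contDiff_dilation.continuous

theorem hasFDerivAt_source (p : V × V) : HasFDerivAt source
    (ContinuousLinearMap.fst ℝ V V + (‖p.1‖ ^ 2 • ContinuousLinearMap.snd ℝ V V +
      ((2 • innerSL ℝ p.1).comp (ContinuousLinearMap.fst ℝ V V)).smulRight p.2)) p :=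
  hasFDerivAt_fst.add
    (((hasStrictFDerivAt_norm_sq p.1).hasFDerivAt.comp p hasFDerivAt_fst).fun_smul hasFDerivAt_snd)

variable (V) in
/-- The weighted blow-up of the pair groupoid of `V` at the origin: the arrow `(x, a)` goes from
`x + |x|² a` to `x`. -/
def blowUpGroupoid : LieGroupoid (blowUpArrows V) V where
  isOpen_arrows := isOpen_blowUpArrows
  src g := source g
  tgt g := g.1.1
  unit x := ⟨(x, 0), mem_blowUpArrows_iff.2 (by simp [dilation])⟩
  inv g := ⟨inverse g, mem_blowUpArrows_iff.2 (by
    rw [dilation_inverse (mem_blowUpArrows_iff.1 g.2)]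
    exact inv_ne_zero (mem_blowUpArrows_iff.1 g.2))⟩
  mul g h e := ⟨product g h, mem_blowUpArrows_iff.2 (by
    rw [dilation_product e]
    exact mul_ne_zero (mem_blowUpArrows_iff.1 g.2) (mem_blowUpArrows_iff.1 h.2))⟩
  src_unit x := by simp [source]
  tgt_unit _ := rfl
  src_inv g := source_inverse (mem_blowUpArrows_iff.1 g.2)
  tgt_inv _ := rfl
  src_mul _ _ e := source_product e
  tgt_mul _ _ _ := rfl
  unit_mul g := Subtype.ext (by simp [product, dilation])
  mul_unit g := Subtype.ext (by simp [product])
  mul_assoc g h k e e' := Subtype.ext (by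
    refine Prod.ext rfl ?_
    change (g.1.2 + dilation g.1 • h.1.2) + dilation (product g.1 h) • k.1.2
      = g.1.2 + dilation g.1 • (h.1.2 + dilation h.1 • k.1.2)
    rw [dilation_product e]
    module)
  inv_mul g := Subtype.ext (by
    refine Prod.ext rfl ?_
    change -((dilation g.1)⁻¹ • g.1.2) + dilation (inverse g.1) • g.1.2 = 0
    rw [dilation_inverse (mem_blowUpArrows_iff.1 g.2), neg_add_cancel])
  mul_inv g := Subtype.ext (by
    refine Prod.ext rfl ?_
    change g.1.2 + dilation g.1 • -((dilation g.1)⁻¹ • g.1.2) = 0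
    rw [smul_neg, smul_inv_smul₀ (mem_blowUpArrows_iff.1 g.2), add_neg_cancel])
  smooth_src := .of_contDiffOn contDiff_source.contDiffOn fun _ => rfl
  smooth_tgt := .of_contDiffOn contDiff_fst.contDiffOn fun _ => rfl
  smooth_unit := contDiff_id.prodMk contDiff_const
  smooth_inv := .of_contDiffOn contDiffOn_inverse fun _ => rfl
  smooth_mul := ⟨_, contDiff_product.contDiffOn, fun _ _ _ => rfl⟩
  submersion_src g v := by
    rw [differential_eq_of_hasFDerivAt isOpen_blowUpArrows (fun _ => rfl) (hasFDerivAt_source g.1)]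
    by_cases hx : g.1.1 = 0
    · exact ⟨(v, 0), by simp [hx]⟩
    · have hn : ‖g.1.1‖ ^ 2 ≠ 0 := by simpa using hx
      exact ⟨(0, (‖g.1.1‖ ^ 2)⁻¹ • v), by simp [smul_smul, mul_inv_cancel₀ hn]⟩
  submersion_tgt g v := by
    rw [differential_eq_of_hasFDerivAt isOpen_blowUpArrows (fun _ => rfl)
      (hasFDerivAt_fst (p := (g : V × V)))]
    exact ⟨(v, 0), rfl⟩

end BlowUp

theorem extendsPairGroupoid_blowUpGroupoid : ExtendsPairGroupoid (blowUpGroupoid Plane) where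
  src_eq _ _ := rfl
  tgt_eq _ _ := rfl
  unit_eq x _ := by simp [blowDown, blowUpGroupoid]
  inv_eq g _ := Prod.ext rfl (source_inverse (mem_blowUpArrows_iff.1 g.2))
  mul_eq _ _ e _ _ := Prod.ext rfl (source_product e)

theorem dense_fst_ne_zero (E F : Type*) [NormedAddCommGroup E] [NormedSpace ℝ E] [Nontrivial E]
    [TopologicalSpace F] : Dense {p : E × F | p.1 ≠ 0} :=
  have := Module.punctured_nhds_neBot ℝ E 0
  (dense_compl_singleton (0 : E)).preimage isOpenMap_fst

theorem ExtendsPairGroupoid.eq_blowUpGroupoid {𝒢 : LieGroupoid arrows Plane}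
    (h𝒢 : ExtendsPairGroupoid 𝒢) : 𝒢 = blowUpGroupoid Plane := by
  have h₀ := extendsPairGroupoid_blowUpGroupoid
  have hD : Dense {g : arrows | g.1.1 ≠ 0} :=
    (dense_fst_ne_zero Plane Plane).preimage 𝒢.isOpen_arrows.isOpenMap_subtype_val
  refine LieGroupoid.eq_of_eqOn_dense hD
    (fun g hg => (h𝒢.src_eq g hg).trans (h₀.src_eq g hg).symm)
    (fun g hg => (h𝒢.tgt_eq g hg).trans (h₀.tgt_eq g hg).symm) fun g hg h e e' => ?_
  have hh : h.1.1 ≠ 0 := ne_of_eq_of_ne e'.symm (bijOn_blowDown.mapsTo ⟨g.2, hg⟩).2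
  have hmul := h𝒢.mul_eq g h e hg hh
  have hmul₀ := h₀.mul_eq g h e' hg hh
  have hfst : (blowDown (𝒢.mul g h e)).1 ≠ 0 := ne_of_eq_of_ne (congrArg Prod.fst hmul) hg
  exact Subtype.ext (bijOn_blowDown.injOn ⟨(𝒢.mul g h e).2, hfst⟩
    ⟨((blowUpGroupoid Plane).mul g h e').2, hg⟩ (hmul.trans hmul₀.symm))

section Algebroid

variable {V : Type*} [NormedAddCommGroup V] [InnerProductSpace ℝ V]

theorem differential_src_blowUpGroupoid (g : blowUpArrows V) :
    differential (blowUpGroupoid V).src g =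
      ContinuousLinearMap.fst ℝ V V + (‖g.1.1‖ ^ 2 • ContinuousLinearMap.snd ℝ V V +
        ((2 • innerSL ℝ g.1.1).comp (ContinuousLinearMap.fst ℝ V V)).smulRight g.1.2) :=
  differential_eq_of_hasFDerivAt isOpen_blowUpArrows (fun _ => rfl) (hasFDerivAt_source g.1)

theorem differential_tgt_blowUpGroupoid (g : blowUpArrows V) :
    differential (blowUpGroupoid V).tgt g = ContinuousLinearMap.fst ℝ V V :=
  differential_eq_of_hasFDerivAt (f' := Prod.fst) isOpen_blowUpArrows (fun _ => rfl)
    hasFDerivAt_fst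

/-- The right-invariant vector field on the arrows of `blowUpGroupoid V` that is related to
`|x|² X` by the target map. -/
def rightInvariantField (X : V → V) (p : V × V) : V × V :=
  (‖p.1‖ ^ 2 • X p.1, -X p.1 - (2 * inner ℝ p.1 (X p.1)) • p.2)

theorem contDiff_rightInvariantField {X : V → V} (hX : ContDiff ℝ ∞ X) :
    ContDiff ℝ ∞ (rightInvariantField X) := by
  have hX' : ContDiff ℝ ∞ fun p : V × V => X p.1 := hX.comp contDiff_fst
  exact ((contDiff_fst.norm_sq ℝ).smul hX').prodMk
    (hX'.neg.sub ((contDiff_const.mul (contDiff_fst.inner ℝ hX')).smul contDiff_snd))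

theorem differential_src_rightInvariantField (X : V → V) (g : blowUpArrows V) :
    differential (blowUpGroupoid V).src g (rightInvariantField X g.1) = 0 := by
  rw [differential_src_blowUpGroupoid]
  simp only [rightInvariantField, add_apply, smul_apply, ContinuousLinearMap.coe_fst',
    ContinuousLinearMap.coe_snd', ContinuousLinearMap.smulRight_apply,
    ContinuousLinearMap.comp_apply, innerSL_apply_apply, inner_smul_right]
  module

theorem hasDerivAt_dilation_of_rightInvariantField (X : V → V) {γ : ℝ → V × V} {t : ℝ}
    (hγ : HasDerivAt γ (rightInvariantField X (γ t)) t) :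
    HasDerivAt (fun τ => dilation (γ τ))
      (-(2 * inner ℝ (γ t).1 (X (γ t).1)) * dilation (γ t)) t := by
  have hx : HasDerivAt (fun τ => (γ τ).1) _ t := hγ.fst
  have ha : HasDerivAt (fun τ => (γ τ).2) _ t := hγ.snd
  refine ((((hx.inner ℝ ha).const_mul 2).const_add 1).add (hx.norm_sq.mul ha.norm_sq)).congr_deriv
    ?_
  simp only [rightInvariantField, dilation, inner_sub_right, inner_neg_right,
    inner_smul_right, real_inner_smul_left, real_inner_self_eq_norm_sq]
  rw [real_inner_comm (γ t).2 (X (γ t).1)]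
  ring

theorem isRightInvariant_rightInvariantField {X : V → V} (hX : ContDiff ℝ ∞ X) :
    (blowUpGroupoid V).IsRightInvariant (rightInvariantField X) := by
  refine ⟨(contDiff_rightInvariantField hX).contDiffOn, differential_src_rightInvariantField X, ?_⟩
  rintro _ h e γ hγ rfl hd
  have hx : HasDerivAt (fun τ => (γ τ).1.1) _ 0 := hd.fst
  have ha : HasDerivAt (fun τ => (γ τ).1.2) _ 0 := hd.snd
  have hdil := hasDerivAt_dilation_of_rightInvariantField X hd
  refine (hx.prodMk (ha.add (hdil.smul_const h.1.2))).congr_deriv (Prod.ext rfl ?_)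
  simp only [rightInvariantField, blowUpGroupoid, product]
  module

theorem fderiv_norm_sq_smul {X : V → V} {x : V} (hX : DifferentiableAt ℝ X x) (v : V) :
    fderiv ℝ (fun y => ‖y‖ ^ 2 • X y) x v = ‖x‖ ^ 2 • fderiv ℝ X x v + (2 * inner ℝ x v) • X x := by
  have hsq : HasFDerivAt (fun y : V => ‖y‖ ^ 2) (2 • innerSL ℝ x) x :=
    (hasStrictFDerivAt_norm_sq x).hasFDerivAt
  rw [(hsq.fun_smul hX.hasFDerivAt).fderiv]
  simp

theorem fderiv_rightInvariantField {X : V → V} {x : V} (hX : DifferentiableAt ℝ X x) (v a : V) :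
    fderiv ℝ (rightInvariantField X) (x, 0) (v, a) =
      (fderiv ℝ (fun y => ‖y‖ ^ 2 • X y) x v, -fderiv ℝ X x v - (2 * inner ℝ x (X x)) • a) := by
  have comp_fst {f : V → V} (hf : DifferentiableAt ℝ f x) : HasFDerivAt (fun p : V × V => f p.1)
      ((fderiv ℝ f x).comp (ContinuousLinearMap.fst ℝ V V)) (x, 0) :=
    HasFDerivAt.comp (g := f) (x, (0 : V)) hf.hasFDerivAt hasFDerivAt_fst
  have hfirst := comp_fst ((differentiableAt_id.norm_sq ℝ).fun_smul hX)
  have hinner : HasFDerivAt (fun p : V × V => 2 * inner ℝ p.1 (X p.1)) _ (x, 0) :=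
    (hasFDerivAt_fst.inner ℝ (comp_fst hX)).const_mul 2
  have h : HasFDerivAt (rightInvariantField X) _ (x, 0) :=
    hfirst.prodMk ((comp_fst hX).neg.sub (hinner.fun_smul hasFDerivAt_snd))
  rw [h.fderiv]
  simp

/-- The isomorphism from the trivial bundle, regarded as the bundle of vector fields `|x|² X`, onto
the Lie algebroid of `blowUpGroupoid V`. -/
def algebroidFrame (x : V) : V →L[ℝ] V × V :=
  (‖x‖ ^ 2 • ContinuousLinearMap.id ℝ V).prod (-ContinuousLinearMap.id ℝ V)

theorem algebroidFrame_apply (x v : V) : algebroidFrame x v = (‖x‖ ^ 2 • v, -v) := rfl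

theorem rightInvariantField_unit (X : V → V) (x : V) :
    rightInvariantField X ((blowUpGroupoid V).unit x) = algebroidFrame x (X x) := by
  simp [rightInvariantField, blowUpGroupoid, algebroidFrame_apply]

theorem lieBracket_rightInvariantField {X Y : V → V} {x : V} (hX : DifferentiableAt ℝ X x)
    (hY : DifferentiableAt ℝ Y x) :
    VectorField.lieBracket ℝ (rightInvariantField X) (rightInvariantField Y) (x, 0) =
      algebroidFrame x (‖x‖ ^ 2 • VectorField.lieBracket ℝ X Y x
        + (2 * inner ℝ x (X x)) • Y x - (2 * inner ℝ x (Y x)) • X x) := by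
  have apply_unit (Z : V → V) : rightInvariantField Z (x, 0) = (‖x‖ ^ 2 • Z x, -Z x) :=
    rightInvariantField_unit Z x
  rw [VectorField.lieBracket, apply_unit, apply_unit, fderiv_rightInvariantField hX,
    fderiv_rightInvariantField hY, fderiv_norm_sq_smul hX, fderiv_norm_sq_smul hY,
    algebroidFrame_apply, VectorField.lieBracket]
  simp only [map_smul, inner_smul_right]
  refine Prod.ext ?_ ?_ <;> dsimp only [Prod.fst_sub, Prod.snd_sub] <;> module

theorem contDiff_algebroidFrame : ContDiff ℝ ∞ (algebroidFrame : V → V →L[ℝ] V × V) := by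
  have h : (algebroidFrame : V → V →L[ℝ] V × V) = fun x =>
      (ContinuousLinearMap.inl ℝ V V).comp (‖x‖ ^ 2 • ContinuousLinearMap.id ℝ V) -
        ContinuousLinearMap.inr ℝ V V := by
    ext x v <;> simp [algebroidFrame_apply]
  rw [h]
  exact (contDiff_const.clm_comp ((contDiff_norm_sq ℝ).smul contDiff_const)).sub contDiff_const

theorem algebroidFrame_injective (x : V) : Function.Injective (algebroidFrame x) :=
  fun _ _ h => neg_injective (congrArg Prod.snd h)

theorem range_algebroidFrame (x : V) :
    LinearMap.range (algebroidFrame x).toLinearMap = (blowUpGroupoid V).algebroidFibre x := by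
  ext ⟨v, a⟩
  have hker : (v, a) ∈ (blowUpGroupoid V).algebroidFibre x ↔ v + ‖x‖ ^ 2 • a = 0 := by
    rw [LieGroupoid.algebroidFibre, differential_src_blowUpGroupoid]
    simp [blowUpGroupoid]
  rw [hker]
  constructor
  · rintro ⟨w, hw⟩
    obtain ⟨rfl, rfl⟩ := Prod.mk.inj hw
    simp
  · intro h
    refine ⟨-a, Prod.ext ?_ (neg_neg a)⟩
    exact (smul_neg _ a).trans (eq_neg_of_add_eq_zero_left h).symm

theorem algebroidAnchor_algebroidFrame (x v : V) :
    (blowUpGroupoid V).algebroidAnchor x (algebroidFrame x v) = ‖x‖ ^ 2 • v := by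
  rw [LieGroupoid.algebroidAnchor, differential_tgt_blowUpGroupoid]
  rfl

theorem isAlgebroidBracket_algebroidFrame {X Y : V → V} (hX : ContDiff ℝ ∞ X)
    (hY : ContDiff ℝ ∞ Y) :
    (blowUpGroupoid V).IsAlgebroidBracket (fun x => algebroidFrame x (X x))
      (fun x => algebroidFrame x (Y x))
      (fun x => algebroidFrame x (‖x‖ ^ 2 • VectorField.lieBracket ℝ X Y x
        + (2 * inner ℝ x (X x)) • Y x - (2 * inner ℝ x (Y x)) • X x)) :=
  ⟨rightInvariantField X, rightInvariantField Y, isRightInvariant_rightInvariantField hX,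
    isRightInvariant_rightInvariantField hY, rightInvariantField_unit X,
    rightInvariantField_unit Y, fun _ => (lieBracket_rightInvariantField
      (hX.contDiffAt.differentiableAt (by simp)) (hY.contDiffAt.differentiableAt (by simp))).symm⟩

end Algebroid

theorem integrates_span : (blowUpGroupoid Plane).Integrates spanAnchor spanBracket :=
  ⟨algebroidFrame, contDiff_algebroidFrame, algebroidFrame_injective, range_algebroidFrame,
    algebroidAnchor_algebroidFrame, fun _ _ hX hY => isAlgebroidBracket_algebroidFrame hX hY⟩

section Plane

theorem Plane.inner_eq (x y : Plane) : inner ℝ x y = x 0 * y 0 + x 1 * y 1 := by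
  simp [PiLp.inner_apply, Fin.sum_univ_two, mul_comm]

theorem Plane.norm_sq_eq (x : Plane) : ‖x‖ ^ 2 = x 0 ^ 2 + x 1 ^ 2 := by
  simp [EuclideanSpace.norm_sq_eq, Fin.sum_univ_two]

/-- The standard frame `∂₁, ∂₂` of the plane. -/
def frame (i : Fin 2) : Plane := EuclideanSpace.single i 1

theorem Plane.eq_sum_frame (x : Plane) : x = x 0 • frame 0 + x 1 • frame 1 := by
  ext i
  fin_cases i <;> simp [frame]

theorem Plane.map_eq (ξ : Plane →L[ℝ] ℝ) (x : Plane) :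
    ξ x = x 0 * ξ (frame 0) + x 1 * ξ (frame 1) := by
  conv_lhs => rw [x.eq_sum_frame]
  rw [map_add, map_smul, map_smul, smul_eq_mul, smul_eq_mul]

/-- The bundle map `T*ℝ² → Tℝ²` of the bivector field `∂₁ ∧ ∂₂`. -/
def standardSharp : (Plane →L[ℝ] ℝ) →L[ℝ] Plane :=
  (ContinuousLinearMap.apply ℝ ℝ (frame 1)).smulRight (frame 0) -
    (ContinuousLinearMap.apply ℝ ℝ (frame 0)).smulRight (frame 1)

theorem standardSharp_apply_zero (ξ : Plane →L[ℝ] ℝ) : standardSharp ξ 0 = ξ (frame 1) := by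
  simp [standardSharp, frame]

theorem standardSharp_apply_one (ξ : Plane →L[ℝ] ℝ) : standardSharp ξ 1 = -ξ (frame 0) := by
  simp [standardSharp, frame]

theorem bijective_standardSharp : Function.Bijective standardSharp := by
  constructor
  · refine (injective_iff_map_eq_zero _).2 fun ξ h => ContinuousLinearMap.ext fun v => ?_
    have h₀ : -ξ (frame 0) = 0 := by rw [← standardSharp_apply_one, h, PiLp.zero_apply]
    have h₁ : ξ (frame 1) = 0 := by rw [← standardSharp_apply_zero, h, PiLp.zero_apply]
    rw [Plane.map_eq, neg_eq_zero.1 h₀, h₁, mul_zero, mul_zero, add_zero,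
      zero_apply]
  · intro v
    refine ⟨v 0 • EuclideanSpace.proj 1 - v 1 • EuclideanSpace.proj 0, ?_⟩
    ext i
    fin_cases i <;> simp [standardSharp, frame]

theorem apply_standardSharp (ξ η : Plane →L[ℝ] ℝ) : ξ (standardSharp η) =
    ξ (frame 0) * η (frame 1) - ξ (frame 1) * η (frame 0) := by
  rw [Plane.map_eq, standardSharp_apply_zero, standardSharp_apply_one]
  ring

theorem apply_standardSharp_comm (ξ η : Plane →L[ℝ] ℝ) :
    ξ (standardSharp η) = -η (standardSharp ξ) := by
  rw [apply_standardSharp, apply_standardSharp]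
  ring

theorem standardSharp_cyclic (ξ η ζ : Plane →L[ℝ] ℝ) :
    ξ (standardSharp η) • standardSharp ζ + η (standardSharp ζ) • standardSharp ξ
      + ζ (standardSharp ξ) • standardSharp η = 0 := by
  ext i
  fin_cases i <;>
  · simp only [Fin.zero_eta, Fin.mk_one, PiLp.add_apply, PiLp.smul_apply, PiLp.zero_apply,
      smul_eq_mul, standardSharp_apply_zero, standardSharp_apply_one, apply_standardSharp]
    ring

end Plane

section Cotangent

variable {f : Plane → ℝ} {α β : Plane → Plane →L[ℝ] ℝ} {x : Plane}

theorem fderiv_smul_standardSharp (hf : DifferentiableAt ℝ f x) (hα : DifferentiableAt ℝ α x)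
    (v : Plane) : fderiv ℝ (fun y => f y • standardSharp (α y)) x v =
      f x • standardSharp (fderiv ℝ α x v) + fderiv ℝ f x v • standardSharp (α x) := by
  have h := hf.hasFDerivAt.fun_smul (standardSharp.hasFDerivAt.comp x hα.hasFDerivAt)
  exact DFunLike.congr_fun h.fderiv v

theorem fderiv_norm_sq_mul (hf : DifferentiableAt ℝ f x) :
    fderiv ℝ (fun y => ‖y‖ ^ 2 * f y) x = ‖x‖ ^ 2 • fderiv ℝ f x + (2 * f x) • innerSL ℝ x := by
  have hsq : HasFDerivAt (fun y : Plane => ‖y‖ ^ 2) (2 • innerSL ℝ x) x :=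
    (hasStrictFDerivAt_norm_sq x).hasFDerivAt
  rw [(hsq.fun_mul hf.hasFDerivAt).fderiv]
  module

theorem cotangentBracket_smul_standardSharp {P : Plane → (Plane →L[ℝ] ℝ) →L[ℝ] Plane}
    (hP : ∀ y ξ, P y ξ = f y • standardSharp ξ) (hf : DifferentiableAt ℝ f x)
    (hα : DifferentiableAt ℝ α x) (hβ : DifferentiableAt ℝ β x) :
    cotangentBracket P α β x =
      f x • (fderiv ℝ β x (standardSharp (α x)) - fderiv ℝ α x (standardSharp (β x)))
        - α x (standardSharp (β x)) • fderiv ℝ f x := by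
  have hPα : DifferentiableAt ℝ (fun y => f y • standardSharp (α y)) x :=
    hf.fun_smul (standardSharp.differentiableAt.comp x hα)
  ext w
  have hcomm := apply_standardSharp_comm (fderiv ℝ β x w) (α x)
  simp only [cotangentBracket, lieDerivOneForm, hP, sub_apply, add_apply,
    ContinuousLinearMap.comp_apply, ContinuousLinearMap.flip_apply, fderiv_clm_apply hβ hPα,
    fderiv_smul_standardSharp hf hβ]
  simp only [smul_apply, sub_apply, map_smul, map_add, smul_eq_mul]
  linear_combination -(f x) * hcomm

theorem spanBracket_smul_standardSharp (hf : DifferentiableAt ℝ f x)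
    (hα : DifferentiableAt ℝ α x) (hβ : DifferentiableAt ℝ β x) :
    spanBracket (fun y => f y • standardSharp (α y)) (fun y => f y • standardSharp (β y)) x =
      f x • ((‖x‖ ^ 2 * f x) • standardSharp
          (fderiv ℝ β x (standardSharp (α x)) - fderiv ℝ α x (standardSharp (β x)))
        + fderiv ℝ (fun y => ‖y‖ ^ 2 * f y) x (standardSharp (α x)) • standardSharp (β x)
        - fderiv ℝ (fun y => ‖y‖ ^ 2 * f y) x (standardSharp (β x)) • standardSharp (α x)) := by
  simp only [spanBracket, VectorField.lieBracket, fderiv_smul_standardSharp hf hα,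
    fderiv_smul_standardSharp hf hβ, fderiv_norm_sq_mul hf, add_apply, smul_apply,
    innerSL_apply_apply, map_smul, map_sub, smul_eq_mul, inner_smul_right]
  module

theorem smul_standardSharp_cotangentBracket {P : Plane → (Plane →L[ℝ] ℝ) →L[ℝ] Plane}
    (hP : ∀ y ξ, P y ξ = (‖y‖ ^ 2 * f y) • standardSharp ξ) (hf : DifferentiableAt ℝ f x)
    (hα : DifferentiableAt ℝ α x) (hβ : DifferentiableAt ℝ β x) :
    f x • standardSharp (cotangentBracket P α β x) =
      spanBracket (fun y => f y • standardSharp (α y)) (fun y => f y • standardSharp (β y)) x := by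
  have hr2f : DifferentiableAt ℝ (fun y => ‖y‖ ^ 2 * f y) x :=
    (differentiableAt_id.norm_sq ℝ).fun_mul hf
  rw [cotangentBracket_smul_standardSharp hP hr2f hα hβ, spanBracket_smul_standardSharp hf hα hβ,
    map_sub, map_smul, map_smul]
  set df := fderiv ℝ (fun y => ‖y‖ ^ 2 * f y) x
  have hcyc := standardSharp_cyclic (α x) (β x) df
  rw [apply_standardSharp_comm (β x) df] at hcyc
  linear_combination (norm := module) -(f x) • hcyc

end Cotangent

theorem integrates_cotangentBracket {P : Plane → (Plane →L[ℝ] ℝ) →L[ℝ] Plane} {f : Plane → ℝ}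
    (hf : ContDiff ℝ ∞ f) (hf0 : ∀ x, f x ≠ 0)
    (hP : ∀ x ξ, P x ξ = (‖x‖ ^ 2 * f x) • standardSharp ξ) :
    (blowUpGroupoid Plane).Integrates P (cotangentBracket P) :=
  integrates_span.of_bundleIso (Ψ := fun x => f x • standardSharp) (hf.smul contDiff_const)
    (fun x => (MulAction.bijective (Units.mk0 _ (hf0 x))).comp bijective_standardSharp)
    (fun x ξ => by rw [hP, mul_smul]; rfl)
    (fun _ _ hα hβ x => smul_standardSharp_cotangentBracket hP (hf.differentiable (by simp) x)
      (hα.differentiable (by simp) x) (hβ.differentiable (by simp) x))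

section EllipticFields

theorem eq_of_norm_sq_smul_eq {V F : Type*} [NormedAddCommGroup V] [NormedSpace ℝ V] [Nontrivial V]
    [TopologicalSpace F] [T2Space F] [AddCommGroup F] [Module ℝ F] {f g : V → F}
    (hf : Continuous f) (hg : Continuous g) (h : ∀ x, ‖x‖ ^ 2 • f x = ‖x‖ ^ 2 • g x) : f = g := by
  have : (nhdsWithin (0 : V) {0}ᶜ).NeBot := Module.punctured_nhds_neBot ℝ V 0
  refine hf.ext_on (dense_compl_singleton (0 : V)) hg fun x hx => ?_
  exact (IsUnit.mk0 _ (pow_ne_zero 2 (norm_ne_zero_iff.2 hx))).smul_left_cancel.1 (h x)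

/-- The smooth function `r²`. -/
def radiusSq : smoothFunctions := ⟨fun x => ‖x‖ ^ 2, (contDiff_norm_sq ℝ : ContDiff ℝ ∞ _)⟩

theorem radiusSq_mul_cancel {f g : smoothFunctions} (h : radiusSq * f = radiusSq * g) : f = g :=
  Subtype.ext <| eq_of_norm_sq_smul_eq (smoothFunctions_contDiff f).continuous
    (smoothFunctions_contDiff g).continuous (congrFun (congrArg Subtype.val h))

theorem mem_ellipticIdeal {f : smoothFunctions} :
    f ∈ ellipticIdeal ↔ ∃ g, f = radiusSq * g :=
  Ideal.mem_span_singleton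

/-- A shortcut: the search for this instance from scratch exceeds the default limit. -/
instance : SMul smoothFunctions ellipticFields :=
  ellipticFields.module.toDistribMulAction.toDistribSMul.toSMul

theorem contDiff_ellipticField (X : ellipticFields) : ContDiff ℝ ∞ (X : Plane → Plane) :=
  X.2.choose

theorem mem_ellipticFields {X : Plane → Plane} (hX : ContDiff ℝ ∞ X) : X ∈ ellipticFields ↔
    ∃ h : smoothFunctions, ∀ x, inner ℝ x (X x) = ‖x‖ ^ 2 * (h : Plane → ℝ) x := by
  have hderiv (g : smoothFunctions) (x : Plane) :
      (derivAlong X hX (radiusSq * g) : Plane → ℝ) x =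
        ‖x‖ ^ 2 * fderiv ℝ (g : Plane → ℝ) x (X x)
          + 2 * (g : Plane → ℝ) x * inner ℝ x (X x) :=
    DFunLike.congr_fun (fderiv_norm_sq_mul
      ((smoothFunctions_contDiff g).differentiable (by simp) x)) (X x)
  constructor
  · rintro ⟨_, h⟩
    obtain ⟨g, hg⟩ := mem_ellipticIdeal.1 (h _ (mem_ellipticIdeal.2 ⟨1, rfl⟩))
    refine ⟨(1 / 2 : ℝ) • g, fun x => ?_⟩
    have hgx : ‖x‖ ^ 2 * fderiv ℝ (fun _ : Plane => (1 : ℝ)) x (X x) + 2 * 1 * inner ℝ x (X x) =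
        ‖x‖ ^ 2 * (g : Plane → ℝ) x :=
      (hderiv 1 x).symm.trans (congrFun (congrArg Subtype.val hg) x)
    rw [fderiv_fun_const, Pi.zero_apply, zero_apply] at hgx
    change _ = ‖x‖ ^ 2 * ((1 / 2 : ℝ) * (g : Plane → ℝ) x)
    linear_combination hgx / 2
  · rintro ⟨h, hh⟩
    refine ⟨hX, fun f hf => ?_⟩
    obtain ⟨g, rfl⟩ := mem_ellipticIdeal.1 hf
    refine mem_ellipticIdeal.2 ⟨derivAlong X hX g + 2 * g * h,
      Subtype.ext <| funext fun x => (hderiv g x).trans ?_⟩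
    change _ = ‖x‖ ^ 2 * (fderiv ℝ (g : Plane → ℝ) x (X x)
      + 2 * (g : Plane → ℝ) x * (h : Plane → ℝ) x)
    rw [hh]
    ring

/-- The Euler vector field `r ∂_r`. -/
def eulerField : ellipticFields :=
  ⟨id, (mem_ellipticFields contDiff_id).2 ⟨1, fun x =>
    (real_inner_self_eq_norm_sq x).trans (mul_one _).symm⟩⟩

/-- The rotation of the plane by a positive quarter turn. -/
def quarterTurn : Plane →L[ℝ] Plane :=
  (EuclideanSpace.proj 0).smulRight (frame 1) - (EuclideanSpace.proj 1).smulRight (frame 0)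

theorem quarterTurn_apply_zero (x : Plane) : quarterTurn x 0 = -x 1 := by
  simp [quarterTurn, frame]

theorem quarterTurn_apply_one (x : Plane) : quarterTurn x 1 = x 0 := by
  simp [quarterTurn, frame]

theorem inner_quarterTurn_self (x : Plane) : inner ℝ x (quarterTurn x) = 0 := by
  rw [Plane.inner_eq, quarterTurn_apply_zero, quarterTurn_apply_one]
  ring

theorem quarterTurn_injective : Function.Injective quarterTurn := by
  refine (injective_iff_map_eq_zero _).2 fun x hx => ?_
  rw [x.eq_sum_frame, ← quarterTurn_apply_one, ← neg_neg (x 1), ← quarterTurn_apply_zero, hx]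
  simp

theorem norm_sq_smul_eq_inner_smul_add (x v : Plane) :
    ‖x‖ ^ 2 • v = inner ℝ x v • x + inner ℝ (quarterTurn x) v • quarterTurn x := by
  ext i
  fin_cases i <;>
  · simp only [Fin.zero_eta, Fin.mk_one, PiLp.add_apply, PiLp.smul_apply, smul_eq_mul,
      Plane.inner_eq, Plane.norm_sq_eq, quarterTurn_apply_zero, quarterTurn_apply_one]
    ring

theorem map_quarterTurn_smul_sub (ξ : Plane →L[ℝ] ℝ) (x : Plane) :
    ξ (quarterTurn x) • x - ξ x • quarterTurn x = ‖x‖ ^ 2 • standardSharp ξ := by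
  rw [Plane.map_eq ξ x, Plane.map_eq ξ (quarterTurn x)]
  ext i
  fin_cases i <;>
  · simp only [Fin.zero_eta, Fin.mk_one, PiLp.sub_apply, PiLp.smul_apply, smul_eq_mul,
      Plane.norm_sq_eq, quarterTurn_apply_zero, quarterTurn_apply_one, standardSharp_apply_zero,
      standardSharp_apply_one]
    ring

/-- The rotational vector field `∂_θ`. -/
def rotationField : ellipticFields :=
  ⟨quarterTurn, (mem_ellipticFields quarterTurn.contDiff).2 ⟨0, fun x =>
    (inner_quarterTurn_self x).trans (mul_zero _).symm⟩⟩

theorem exists_radialCoefficient (X : ellipticFields) : ∃ h : smoothFunctions,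
    ∀ x, inner ℝ x ((X : Plane → Plane) x) = ‖x‖ ^ 2 * (h : Plane → ℝ) x :=
  (mem_ellipticFields (contDiff_ellipticField X)).1 X.2

theorem ellipticField_apply_zero (X : ellipticFields) : (X : Plane → Plane) 0 = 0 := by
  obtain ⟨h, hh⟩ := exists_radialCoefficient X
  have hX := (contDiff_ellipticField X).differentiable (by simp) 0
  refine ext_inner_left ℝ fun v => ?_
  have hv := DFunLike.congr_fun (congrArg (fderiv ℝ · 0) (funext hh)) v
  rw [fderiv_inner_apply ℝ differentiableAt_fun_id hX,
    fderiv_norm_sq_mul ((smoothFunctions_contDiff h).differentiable (by simp) 0)] at hv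
  simpa using hv

/-- The one-form `d log r` on the elliptic tangent bundle: `X` is sent to the smooth extension of
`⟪x, X x⟫ / r²` across the origin. -/
def dLogRadius : Module.Dual smoothFunctions ellipticFields where
  toFun X := (exists_radialCoefficient X).choose
  map_add' X Y := radiusSq_mul_cancel <| Subtype.ext <| funext fun x => by
    have h := fun Z : ellipticFields => (exists_radialCoefficient Z).choose_spec x
    refine (h (X + Y)).symm.trans ?_
    change inner ℝ x ((X : Plane → Plane) x + (Y : Plane → Plane) x) = ‖x‖ ^ 2 * (_ + _)
    rw [inner_add_right, h, h, mul_add]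
  map_smul' f X := radiusSq_mul_cancel <| Subtype.ext <| funext fun x => by
    have h := fun Z : ellipticFields => (exists_radialCoefficient Z).choose_spec x
    refine (h (f • X)).symm.trans ?_
    change inner ℝ x ((f : Plane → ℝ) x • (X : Plane → Plane) x) = ‖x‖ ^ 2 * (_ * _)
    rw [real_inner_smul_right, h, mul_left_comm]
    rfl

theorem inner_eq_norm_sq_mul_dLogRadius (X : ellipticFields) (x : Plane) :
    inner ℝ x ((X : Plane → Plane) x) = ‖x‖ ^ 2 * (dLogRadius X : Plane → ℝ) x :=
  (exists_radialCoefficient X).choose_spec x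

theorem dLogRadius_eulerField : dLogRadius eulerField = 1 :=
  radiusSq_mul_cancel <| Subtype.ext <| funext fun x =>
    (inner_eq_norm_sq_mul_dLogRadius eulerField x).symm.trans <|
      (real_inner_self_eq_norm_sq x).trans (mul_one _).symm

theorem dLogRadius_rotationField : dLogRadius rotationField = 0 :=
  radiusSq_mul_cancel <| Subtype.ext <| funext fun x =>
    (inner_eq_norm_sq_mul_dLogRadius rotationField x).symm.trans <|
      (inner_quarterTurn_self x).trans (mul_zero _).symm

end EllipticFields

section EllipticForms

variable {Ω : ellipticFields →ₗ[smoothFunctions] Module.Dual smoothFunctions ellipticFields}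

theorem norm_sq_mul_form (X Y : ellipticFields) (x : Plane) :
    ‖x‖ ^ 2 * (Ω X Y : Plane → ℝ) x =
      inner ℝ x ((X : Plane → Plane) x) * (Ω eulerField Y : Plane → ℝ) x
        + inner ℝ (quarterTurn x) ((X : Plane → Plane) x) * (Ω rotationField Y : Plane → ℝ) x := by
  have hX := contDiff_ellipticField X
  let p : smoothFunctions := ⟨fun x => inner ℝ x ((X : Plane → Plane) x), contDiff_id.inner ℝ hX⟩
  let q : smoothFunctions := ⟨fun x => inner ℝ (quarterTurn x) ((X : Plane → Plane) x),
    quarterTurn.contDiff.inner ℝ hX⟩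
  have hpq : radiusSq • X = p • eulerField + q • rotationField :=
    Subtype.ext <| funext fun x => norm_sq_smul_eq_inner_smul_add x ((X : Plane → Plane) x)
  have h := congrArg (Ω · Y) hpq
  simp only [map_add, map_smul] at h
  exact congrFun (congrArg Subtype.val h) x

theorem form_euler_rotation_smul (hΩ : Ω.IsAlt) (X : ellipticFields) (x : Plane) :
    (Ω eulerField rotationField : Plane → ℝ) x • (X : Plane → Plane) x =
      (Ω X rotationField : Plane → ℝ) x • x
        - (Ω X eulerField : Plane → ℝ) x • quarterTurn x := by
  have hcont (Y Z : ellipticFields) : Continuous (Ω Y Z : Plane → ℝ) :=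
    (smoothFunctions_contDiff _).continuous
  refine congrFun (eq_of_norm_sq_smul_eq
    ((hcont _ _).smul (contDiff_ellipticField X).continuous)
    (((hcont _ _).smul continuous_id').sub ((hcont _ _).smul quarterTurn.continuous))
    fun y => ?_) x
  have hR := norm_sq_mul_form (Ω := Ω) X rotationField y
  have hE := norm_sq_mul_form (Ω := Ω) X eulerField y
  have hv := norm_sq_smul_eq_inner_smul_add y ((X : Plane → Plane) y)
  rw [hΩ, ZeroMemClass.coe_zero, Pi.zero_apply, mul_zero, add_zero] at hR
  rw [hΩ, ← hΩ.neg eulerField rotationField, ZeroMemClass.coe_zero, Pi.zero_apply, mul_zero,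
    zero_add] at hE
  change _ = _ * -(Ω eulerField rotationField : Plane → ℝ) y at hE
  simp only [Pi.smul_apply', Pi.sub_apply]
  linear_combination (norm := module) (Ω eulerField rotationField : Plane → ℝ) y • hv
    - hR • y + hE • quarterTurn y

theorem form_euler_rotation_ne_zero (hΩ : Ω.IsAlt) (hsurj : Function.Surjective Ω) (x : Plane) :
    (Ω eulerField rotationField : Plane → ℝ) x ≠ 0 := by
  obtain ⟨Z, hZ⟩ := hsurj dLogRadius
  set u := Ω eulerField rotationField
  have huZ (x : Plane) : (u : Plane → ℝ) x • (Z : Plane → Plane) x = -quarterTurn x := by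
    rw [form_euler_rotation_smul hΩ, hZ, dLogRadius_eulerField, dLogRadius_rotationField,
      ZeroMemClass.coe_zero, OneMemClass.coe_one, Pi.zero_apply, Pi.one_apply, zero_smul, one_smul,
      zero_sub]
  intro hux
  have hx : x = 0 := by
    have h := huZ x
    rw [hux, zero_smul, zero_eq_neg] at h
    exact quarterTurn_injective (h.trans (map_zero _).symm)
  subst hx
  have hu := (smoothFunctions_contDiff u).differentiable (by simp) 0
  have hZd := (contDiff_ellipticField Z).differentiable (by simp) 0
  have hderiv := (hu.hasFDerivAt.smul hZd.hasFDerivAt).unique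
    ((-quarterTurn).hasFDerivAt.congr_of_eventuallyEq (.of_forall huZ))
  rw [hux, ellipticField_apply_zero, zero_smul, zero_add,
    ContinuousLinearMap.smulRight_zero] at hderiv
  have hframe := quarterTurn_apply_one (frame 0)
  rw [neg_eq_zero.1 hderiv.symm] at hframe
  simp [frame] at hframe

end EllipticForms

theorem IsEllipticPoisson.exists_eq_smul_standardSharp {P : Plane → (Plane →L[ℝ] ℝ) →L[ℝ] Plane}
    (hP : IsEllipticPoisson P) : ∃ c : Plane → ℝ, ContDiff ℝ ∞ c ∧ (∀ x, c x ≠ 0) ∧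
      ∀ x ξ, P x ξ = (‖x‖ ^ 2 * c x) • standardSharp ξ := by
  obtain ⟨Ω, hΩ, hP⟩ := hP
  let u : Plane → ℝ := (Ω eulerField rotationField : smoothFunctions)
  have hu0 : ∀ x, u x ≠ 0 := form_euler_rotation_ne_zero hΩ.alternating hΩ.nondegenerate.2
  have hus : ContDiff ℝ ∞ u := smoothFunctions_contDiff _
  refine ⟨fun x => (u x)⁻¹, hus.inv hu0, fun x => inv_ne_zero (hu0 x), fun x ξ => ?_⟩
  obtain ⟨X, hX, hPX⟩ := hP (fun _ => ξ) contDiff_const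
  have huX : u x • (X : Plane → Plane) x = ξ (quarterTurn x) • x - ξ x • quarterTurn x := by
    rw [form_euler_rotation_smul hΩ.alternating, hX, hX]
    rfl
  rw [hPX, mul_comm, mul_smul, ← map_quarterTurn_smul_sub, ← huX, inv_smul_smul₀ (hu0 x)]

end EllipticGroupoid

end

theorem mainTheorem11 :
    ∃ 𝒢 : EllipticGroupoid.LieGroupoid EllipticGroupoid.arrows EllipticGroupoid.Plane,
      EllipticGroupoid.ExtendsPairGroupoid 𝒢 ∧
      (∀ 𝒢' : EllipticGroupoid.LieGroupoid EllipticGroupoid.arrows EllipticGroupoid.Plane,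
        EllipticGroupoid.ExtendsPairGroupoid 𝒢' → 𝒢' = 𝒢) ∧
      (∀ g : EllipticGroupoid.arrows, 𝒢.src g = g.1.1 + ‖g.1.1‖ ^ 2 • g.1.2) ∧
      (∀ g : EllipticGroupoid.arrows, 𝒢.tgt g = g.1.1) ∧
      𝒢.Integrates EllipticGroupoid.spanAnchor EllipticGroupoid.spanBracket ∧
      ∀ P : EllipticGroupoid.Plane →
          (EllipticGroupoid.Plane →L[ℝ] ℝ) →L[ℝ] EllipticGroupoid.Plane,
        EllipticGroupoid.IsEllipticPoisson P →
          𝒢.Integrates P (EllipticGroupoid.cotangentBracket P) := by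
  refine ⟨EllipticGroupoid.blowUpGroupoid EllipticGroupoid.Plane,
    EllipticGroupoid.extendsPairGroupoid_blowUpGroupoid, fun _ h => h.eq_blowUpGroupoid,
    fun _ => rfl, fun _ => rfl, EllipticGroupoid.integrates_span, fun P hP => ?_⟩
  obtain ⟨c, hc, hc0, hPc⟩ := hP.exists_eq_smul_standardSharp
  exact EllipticGroupoid.integrates_cotangentBracket hc hc0 hPc
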